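/- Let $m$ and $n$ be positive integers with $m$ even, and let $w=e^{2\pi i/(2m)}$. Write $$\zeta(\{2m\}^n)=\sum_{1\le k_1<k_2<\cdots<k_n}\frac{1}{k_1^{2m}k_2^{2m}\cdots k_n^{2m}}$$ for the multiple zeta value with $n$ arguments all equal to $2m$. This series converges, and $$\zeta(\{2m\}^n)=\frac{(-1)^{n+1+\frac m2}\,\pi^{2mn}}{2^{m-2}\,(2mn+m)!}\cdot\operatorname{Im}\left(\sum_{\varepsilon}\bigl(w^{m-1}+\varepsilon_1w^{m-2}+\varepsilon_2w^{m-3}+\cdots+\varepsilon_{m-1}\bigr)^{2mn+m}\right),$$ where the sum runs over all vectors $\varepsilon=(\varepsilon_1,\ldots,\varepsilon_{m-1})\in\{1,-1\}^{m-1}$ with $\operatorname{sign}(\varepsilon)=1$, that is, those with an even number of entries equal to $-1$. -/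

import Mathlib

namespace MZV

/-- The term `k₁^(-α₁) ⋯ k_r^(-α_r)` attached to positive integers `k₁ < ⋯ < k_r`. -/
noncomputable def term {r : ℕ} (α : Fin r → ℕ) (k : {k : Fin r → ℕ+ // StrictMono k}) : ℝ :=
  ∏ i, (((k.1 i : ℕ) : ℝ) ^ α i)⁻¹

/-- The multiple zeta value `ζ(α₁, …, α_r) = ∑_{1 ≤ k₁ < ⋯ < k_r} k₁^(-α₁) ⋯ k_r^(-α_r)`. -/
noncomputable def zeta {r : ℕ} (α : Fin r → ℕ) : ℝ :=
  ∑' k : {k : Fin r → ℕ+ // StrictMono k}, term α k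

/-- The argument string `{a}^n`: `n` repetitions of `a`. -/
def rep (a n : ℕ) : Fin n → ℕ := fun _ => a

/-- `sign ε` is `1` if the number of entries `-1` in `ε` is even, and `-1` otherwise. -/
def sign {d : ℕ} (ε : Fin d → ℤˣ) : ℤ :=
  if Even (Finset.univ.filter fun j => ε j = -1).card then 1 else -1

/-- `w^(m-1) + ε₁ w^(m-2) + ε₂ w^(m-3) + ⋯ + ε_{m-1}`; the entry `ε j` is `ε_{j+1}`. -/
def signedSum (m : ℕ) (w : ℂ) (ε : Fin (m - 1) → ℤˣ) : ℂ :=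
  w ^ (m - 1) + ∑ j : Fin (m - 1), ((ε j : ℤ) : ℂ) * w ^ (m - 1 - ((j : ℕ) + 1))

end MZV

namespace MZV

open Filter Topology

/-! The numbers ζ({2m}^n) are, up to sign, the coefficients of ∏ₖ (1 - x^(2m)/k^(2m)). As w² is a
primitive m-th root of unity, each factor splits as ∏ⱼ (1 - (w^j x)²/k²), so Euler's product turns
the whole into ∏ⱼ sin(π w^j x)/(π w^j x) (`hasSum_zeta_prod_sin`). Writing each sine through
exponentials gives a signed sum over all sign vectors (`hasSum_prod_sin`), and the coefficients of
x^(2mn+m) are compared (`zeta_eq_sum_fullSum`). Two symmetries shrink the sum: negation fixes one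
sign, and multiplication by w makes the unsigned power sum vanish, which leaves only even vectors
(`sum_prod_mul_fullSum_pow`). -/

/-- Strictly increasing `n`-tuples correspond to finite sets of cardinality `n`. -/
noncomputable def strictMonoEquivCard (n : ℕ) :
    {k : Fin n → ℕ+ // StrictMono k} ≃ (Finset.card ⁻¹' {n} : Set (Finset ℕ+)) where
  toFun k := ⟨Finset.univ.map ⟨k.1, k.2.injective⟩, by simp⟩
  invFun s := ⟨s.1.orderEmbOfFin s.2, (s.1.orderEmbOfFin s.2).strictMono⟩
  left_inv k := by
    ext1
    exact (Finset.orderEmbOfFin_unique _ (fun i => by simp) k.2).symm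
  right_inv s := by
    ext1
    apply Finset.coe_injective
    rw [Finset.coe_map, Finset.coe_univ, Set.image_univ]
    exact Finset.range_orderEmbOfFin s.1 s.2

lemma prod_strictMonoEquivCard (a n : ℕ) (k : {k : Fin n → ℕ+ // StrictMono k}) :
    ∏ i ∈ (strictMonoEquivCard n k).1, (((i : ℕ) : ℝ) ^ a)⁻¹ = term (rep a n) k := by
  simp [strictMonoEquivCard, term, rep]

lemma summable_inv_pnat_pow {a : ℕ} (ha : 1 < a) :
    Summable fun i : ℕ+ => (((i : ℕ) : ℝ) ^ a)⁻¹ :=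
  (Real.summable_nat_pow_inv.2 ha).comp_injective PNat.coe_injective

lemma summable_prod_inv_pow {a : ℕ} (ha : 1 < a) :
    Summable fun s : Finset ℕ+ => ∏ i ∈ s, (((i : ℕ) : ℝ) ^ a)⁻¹ :=
  summable_finsetProd_of_summable_nonneg (fun i => by positivity) (summable_inv_pnat_pow ha)

lemma summable_term_rep {a : ℕ} (ha : 1 < a) (n : ℕ) : Summable (term (rep a n)) := by
  have h := (summable_prod_inv_pow ha).subtype (Finset.card ⁻¹' {n})
  exact ((strictMonoEquivCard n).summable_iff.2 h).congr fun k => prod_strictMonoEquivCard a n k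

lemma zeta_rep_eq_tsum_card (a n : ℕ) :
    zeta (rep a n) =
      ∑' s : (Finset.card ⁻¹' {n} : Set (Finset ℕ+)), ∏ i ∈ s.1, (((i : ℕ) : ℝ) ^ a)⁻¹ := by
  rw [zeta, ← (strictMonoEquivCard n).tsum_eq]
  exact tsum_congr fun k => (prod_strictMonoEquivCard a n k).symm

/-- The generating function of the values `ζ({a}^n)` is an infinite product. -/
lemma exists_hasSum_zeta_and_hasProd {a : ℕ} (ha : 1 < a) (y : ℂ) :
    ∃ P : ℂ, HasSum (fun n : ℕ => (-y) ^ n * (zeta (rep a n) : ℂ)) P ∧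
      HasProd (fun i : ℕ+ => 1 - y / ((i : ℕ) : ℂ) ^ a) P := by
  have hn : Summable fun i : ℕ+ => ‖-y * (((((i : ℕ) : ℝ) ^ a)⁻¹ : ℝ) : ℂ)‖ := by
    refine ((summable_inv_pnat_pow ha).mul_left ‖y‖).congr fun i => ?_
    rw [norm_mul, norm_neg, Complex.norm_real, Real.norm_of_nonneg (by positivity)]
  obtain ⟨P, hP⟩ := summable_finsetProd_of_summable_norm hn
  refine ⟨P, ?_, ?_⟩
  -- The expanded product is a sum over finite sets; grouping by cardinality collects the powers of
  -- `-y`.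
  · have h := hP.tsum_fiberwise Finset.card
    refine h.congr_fun fun n => ?_
    rw [zeta_rep_eq_tsum_card, Complex.ofReal_tsum, ← tsum_mul_left]
    refine tsum_congr fun s => ?_
    have hs : s.1.card = n := s.2
    rw [Finset.prod_mul_distrib, Finset.prod_const, hs, Complex.ofReal_prod]
  · refine (hasProd_one_add_of_hasSum_prod hP).congr_fun fun i => ?_
    push_cast
    ring

/-! ### Products of sines at rotated arguments -/

lemma one_sub_pow_eq_prod {m : ℕ} (hm : 0 < m) {z : ℂ} (hz : IsPrimitiveRoot z m) (y : ℂ) :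
    1 - y ^ m = ∏ j : Fin m, (1 - z ^ (j : ℕ) * y) := by
  have h := hz.pow_sub_pow_eq_prod_sub_mul 1 y hm
  rw [one_pow] at h
  rw [h, Fin.prod_univ_eq_prod_range (fun j => 1 - z ^ j * y) m, Polynomial.nthRootsFinset,
    Finset.prod_eq_multiset_prod, Multiset.toFinset_val,
    Multiset.dedup_eq_self.2 hz.nthRoots_one_nodup, hz.nthRoots_eq (one_pow m), Multiset.map_map]
  simp [Finset.prod_eq_multiset_prod]

lemma tendsto_prod_sin {m : ℕ} (hm : 0 < m) {w : ℂ} (hw : IsPrimitiveRoot (w ^ 2) m) (x : ℂ) :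
    Tendsto (fun N : ℕ => (∏ j : Fin m, Real.pi * (w ^ (j : ℕ) * x)) *
        ∏ k ∈ Finset.range N, (1 - x ^ (2 * m) / ((k : ℂ) + 1) ^ (2 * m)))
      atTop (𝓝 (∏ j : Fin m, Complex.sin (Real.pi * (w ^ (j : ℕ) * x)))) := by
  refine (tendsto_finsetProd Finset.univ fun (j : Fin m) _ =>
    Complex.tendsto_euler_sin_prod (w ^ (j : ℕ) * x)).congr fun N => ?_
  rw [Finset.prod_mul_distrib, Finset.prod_comm]
  congr 1
  refine Finset.prod_congr rfl fun k _ => ?_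
  rw [pow_mul, pow_mul, ← div_pow, one_sub_pow_eq_prod hm hw]
  refine Finset.prod_congr rfl fun j _ => ?_
  rw [mul_pow, ← pow_mul, ← pow_mul, mul_comm 2 (j : ℕ), mul_div_assoc]

lemma hasSum_zeta_prod_sin {m : ℕ} (hm : 0 < m) {w : ℂ} (hw : IsPrimitiveRoot (w ^ 2) m) (x : ℂ) :
    HasSum (fun n : ℕ => (∏ j : Fin m, Real.pi * (w ^ (j : ℕ) * x)) *
        ((-x ^ (2 * m)) ^ n * (zeta (rep (2 * m) n) : ℂ)))
      (∏ j : Fin m, Complex.sin (Real.pi * (w ^ (j : ℕ) * x))) := by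
  obtain ⟨P, hS, hP⟩ := exists_hasSum_zeta_and_hasProd (a := 2 * m) (by omega) (x ^ (2 * m))
  have h := hS.mul_left (∏ j : Fin m, Real.pi * (w ^ (j : ℕ) * x))
  suffices heq : ∏ j : Fin m, Complex.sin (Real.pi * (w ^ (j : ℕ) * x)) =
      (∏ j : Fin m, Real.pi * (w ^ (j : ℕ) * x)) * P by rwa [heq]
  rw [← Equiv.pnatEquivNat.symm.hasProd_iff] at hP
  refine tendsto_nhds_unique (tendsto_prod_sin hm hw x) ((hP.tendsto_prod_nat.const_mul _).congr
    fun N => ?_)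
  simp

/-- The signed power sum `∑ δ_j w^j` over a full vector of signs. -/
noncomputable def fullSum {m : ℕ} (w : ℂ) (δ : Fin m → ℤˣ) : ℂ :=
  ∑ j : Fin m, ((δ j : ℤ) : ℂ) * w ^ (j : ℕ)

lemma sum_units_int {M : Type*} [AddCommMonoid M] (f : ℤˣ → M) : ∑ u : ℤˣ, f u = f 1 + f (-1) := by
  rw [show (Finset.univ : Finset ℤˣ) = {1, -1} from rfl, Finset.sum_pair (by decide)]

lemma sin_eq_sum_units (z : ℂ) :
    Complex.sin z =
      (2 * Complex.I)⁻¹ * ∑ u : ℤˣ, ((u : ℤ) : ℂ) * Complex.exp (((u : ℤ) : ℂ) * z * Complex.I) := by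
  rw [sum_units_int, Complex.sin, mul_inv, Complex.inv_I]
  push_cast
  ring_nf

lemma prod_sin_eq_sum {m : ℕ} (w x : ℂ) :
    ∏ j : Fin m, Complex.sin (Real.pi * (w ^ (j : ℕ) * x)) =
      ((2 * Complex.I) ^ m)⁻¹ * ∑ δ : Fin m → ℤˣ, ((∏ j, δ j : ℤˣ) : ℂ) *
        Complex.exp (Complex.I * Real.pi * fullSum w δ * x) := by
  simp_rw [sin_eq_sum_units]
  rw [Finset.prod_mul_distrib, Finset.prod_const, Finset.card_univ, Fintype.card_fin,
    Fintype.prod_sum, inv_pow]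
  congr 1
  refine Finset.sum_congr rfl fun δ _ => ?_
  rw [Finset.prod_mul_distrib, ← Complex.exp_sum]
  congr 1
  · push_cast
    rfl
  · congr 1
    rw [fullSum, Finset.mul_sum, Finset.sum_mul]
    exact Finset.sum_congr rfl fun j _ => by ring

lemma hasSum_prod_sin {m : ℕ} (w x : ℂ) :
    HasSum (fun N : ℕ => x ^ N * (((2 * Complex.I) ^ m)⁻¹ * ((Complex.I * Real.pi) ^ N / N.factorial *
        ∑ δ : Fin m → ℤˣ, ((∏ j, δ j : ℤˣ) : ℂ) * fullSum w δ ^ N)))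
      (∏ j : Fin m, Complex.sin (Real.pi * (w ^ (j : ℕ) * x))) := by
  rw [prod_sin_eq_sum]
  have h := (hasSum_sum (s := Finset.univ) fun (δ : Fin m → ℤˣ) _ =>
    (NormedSpace.expSeries_div_hasSum_exp (Complex.I * Real.pi * fullSum w δ * x)).mul_left
      ((∏ j, δ j : ℤˣ) : ℂ)).mul_left ((2 * Complex.I) ^ m)⁻¹
  rw [← Complex.exp_eq_exp_ℂ] at h
  refine h.congr_fun fun N => ?_
  rw [Finset.mul_sum, Finset.mul_sum, Finset.mul_sum, Finset.mul_sum]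
  refine Finset.sum_congr rfl fun δ _ => ?_
  ring

lemma coeff_unique {a b : ℕ → ℂ} {f : ℂ → ℂ} (ha : ∀ x, HasSum (fun N => x ^ N * a N) (f x))
    (hb : ∀ x, HasSum (fun N => x ^ N * b N) (f x)) : a = b := by
  have key : ∀ c : ℕ → ℂ, (∀ x, HasSum (fun N => x ^ N * c N) (f x)) →
      HasFPowerSeriesAt f (FormalMultilinearSeries.ofScalars ℂ c) 0 := fun c hc => by
    rw [hasFPowerSeriesAt_iff]
    exact Eventually.of_forall fun z => by
      simpa [FormalMultilinearSeries.coeff_ofScalars] using hc z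
  have h := (key a ha).eq_formalMultilinearSeries (key b hb)
  funext N
  simpa [FormalMultilinearSeries.coeff_ofScalars] using congrArg (fun p => p.coeff N) h

/-- Comparison of the coefficients of `x ^ (2 * m * n + m)` in the two expansions of
`∏ sin (π w^j x)`. -/
lemma zeta_eq_sum_fullSum {m : ℕ} (hm : 0 < m) {w : ℂ} (hw : IsPrimitiveRoot (w ^ 2) m) (n : ℕ) :
    (Real.pi : ℂ) ^ m * w ^ (m * (m - 1) / 2) * ((-1) ^ n * (zeta (rep (2 * m) n) : ℂ)) =
      ((2 * Complex.I) ^ m)⁻¹ *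
        ((Complex.I * Real.pi) ^ (2 * m * n + m) / (2 * m * n + m).factorial *
        ∑ δ : Fin m → ℤˣ, ((∏ j, δ j : ℤˣ) : ℂ) * fullSum w δ ^ (2 * m * n + m)) := by
  have hinj : Function.Injective fun n : ℕ => 2 * m * n + m := fun p q h => by
    have : 2 * m * p = 2 * m * q := Nat.add_right_cancel h
    exact Nat.eq_of_mul_eq_mul_left (by omega) this
  let c : ℕ → ℂ := fun n =>
    (Real.pi : ℂ) ^ m * w ^ (m * (m - 1) / 2) * ((-1) ^ n * (zeta (rep (2 * m) n) : ℂ))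
  -- The zeta series involves only the exponents `2 * m * n + m`; all other coefficients are set to
  -- 0.
  have h := coeff_unique (a := Function.extend (fun n : ℕ => 2 * m * n + m) c 0)
    (fun x => ?_) (fun x => hasSum_prod_sin (m := m) w x)
  · have h2 := congrFun h (2 * m * n + m)
    rwa [hinj.extend_apply c 0 n] at h2
  · rw [← hinj.hasSum_iff]
    · refine (hasSum_zeta_prod_sin hm hw x).congr_fun fun k => ?_
      simp only [Function.comp_apply, hinj.extend_apply, c]
      rw [Finset.prod_mul_distrib, Finset.prod_mul_distrib, Finset.prod_const, Finset.prod_const,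
        Finset.card_univ, Fintype.card_fin, Finset.prod_pow_eq_pow_sum,
        Fin.sum_univ_eq_sum_range (fun j => j), Finset.sum_range_id, neg_pow (x ^ (2 * m)), ← pow_mul, pow_add]
      ring
    · intro N hN
      rw [Function.extend_apply' _ _ _ hN]
      simp

/-! ### Symmetries of the sums over sign vectors -/

lemma sign_eq_prod {d : ℕ} (ε : Fin d → ℤˣ) : sign ε = ((∏ j, ε j : ℤˣ) : ℤ) := by
  have h : ∏ j, ε j = (-1) ^ (Finset.univ.filter fun j => ε j = -1).card := by
    rw [← Finset.prod_const, Finset.prod_filter]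
    refine Finset.prod_congr rfl fun j _ => ?_
    rcases Int.units_eq_one_or (ε j) with h | h <;> simp [h]
  rw [h, sign]
  split_ifs with he
  · simp [he.neg_one_pow]
  · simp [(Nat.not_even_iff_odd.1 he).neg_one_pow]

lemma fullSum_neg {m : ℕ} (w : ℂ) (δ : Fin m → ℤˣ) : fullSum w (-δ) = -fullSum w δ := by
  simp [fullSum]

/-- Multiplication by `w` acts on sign vectors as a cyclic shift with one sign change. -/
lemma mul_fullSum_snoc {d : ℕ} {w : ℂ} (hw : w ^ (d + 1) = -1) (u : ℤˣ) (ε : Fin d → ℤˣ) :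
    w * fullSum w (Fin.snoc ε u : Fin (d + 1) → ℤˣ) =
      fullSum w (Fin.cons (-u) ε : Fin (d + 1) → ℤˣ) := by
  simp only [fullSum]
  rw [Fin.sum_univ_castSucc, Fin.sum_univ_succ, mul_add, Finset.mul_sum]
  simp only [Fin.snoc_castSucc, Fin.snoc_last, Fin.cons_zero, Fin.cons_succ, Fin.val_castSucc,
    Fin.val_last, Fin.val_zero, Fin.val_succ, pow_zero]
  rw [mul_left_comm, ← pow_succ', hw, add_comm]
  push_cast
  congr 1
  · ring
  · exact Finset.sum_congr rfl fun j _ => by ring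

lemma sum_cons {d : ℕ} (f : (Fin (d + 1) → ℤˣ) → ℂ) :
    ∑ δ, f δ = ∑ u : ℤˣ, ∑ ε : Fin d → ℤˣ, f (Fin.cons u ε) := by
  rw [← (Fin.consEquiv fun _ => ℤˣ).sum_comp, Fintype.sum_prod_type]
  rfl

lemma sum_snoc {d : ℕ} (f : (Fin (d + 1) → ℤˣ) → ℂ) :
    ∑ δ, f δ = ∑ u : ℤˣ, ∑ ε : Fin d → ℤˣ, f (Fin.snoc ε u) := by
  rw [← (Fin.snocEquiv fun _ => ℤˣ).sum_comp, Fintype.sum_prod_type]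
  rfl

/-- Multiplication by `w` permutes the values of `fullSum w`, so the sum equals `w ^ N = -1` times
itself. -/
lemma sum_fullSum_pow_eq_zero {d N : ℕ} {w : ℂ} (hw : w ^ (d + 1) = -1) (hN : w ^ N = -1) :
    ∑ δ : Fin (d + 1) → ℤˣ, fullSum w δ ^ N = 0 := by
  have h : w ^ N * ∑ δ : Fin (d + 1) → ℤˣ, fullSum w δ ^ N =
      ∑ δ : Fin (d + 1) → ℤˣ, fullSum w δ ^ N := by
    conv_lhs => rw [sum_snoc]
    rw [sum_cons, ← Equiv.sum_comp (Equiv.neg ℤˣ), Finset.mul_sum]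
    refine Finset.sum_congr rfl fun u _ => ?_
    rw [Finset.mul_sum]
    refine Finset.sum_congr rfl fun ε _ => ?_
    rw [← mul_pow, mul_fullSum_snoc hw, Equiv.neg_apply, neg_neg]
  rw [hN] at h
  linear_combination -(1 / 2 : ℂ) * h

/-- `signedSum` lists the powers of `w` in decreasing order, hence the reversal; its leading
coefficient is the fixed last sign. -/
lemma signedSum_eq_fullSum {d : ℕ} (w : ℂ) (ε : Fin d → ℤˣ) :
    signedSum (d + 1) w ε = fullSum w (Fin.snoc (ε ∘ Fin.rev) 1 : Fin (d + 1) → ℤˣ) := by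
  rw [fullSum, Fin.sum_univ_castSucc, signedSum, add_comm]
  simp only [Fin.snoc_castSucc, Fin.snoc_last, Fin.val_castSucc, Fin.val_last]
  congr 1
  · refine Fintype.sum_equiv Fin.revPerm _ _ fun j => ?_
    simp [Fin.val_rev]
  · simp

/-- Sums of even powers over all sign vectors reduce to vectors whose last entry is `1`. -/
lemma sum_mul_fullSum_pow {d N : ℕ} (hN : Even N) (w : ℂ) (g : (Fin (d + 1) → ℤˣ) → ℂ)
    (hg : ∀ δ, g (-δ) = g δ) :
    ∑ δ : Fin (d + 1) → ℤˣ, g δ * fullSum w δ ^ N =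
      2 * ∑ ε : Fin d → ℤˣ, g (Fin.snoc (ε ∘ Fin.rev) 1) * signedSum (d + 1) w ε ^ N := by
  have hsnoc : ∀ ε : Fin d → ℤˣ,
      (Fin.snoc (-ε) (-1) : Fin (d + 1) → ℤˣ) = -(Fin.snoc ε 1 : Fin (d + 1) → ℤˣ) := fun ε => by
    funext j
    refine Fin.lastCases ?_ (fun i => ?_) j <;> simp
  have hrev : ∑ ε : Fin d → ℤˣ, g (Fin.snoc (ε ∘ Fin.rev) 1) * signedSum (d + 1) w ε ^ N =
      ∑ ε : Fin d → ℤˣ, g (Fin.snoc ε 1) * fullSum w (Fin.snoc ε 1 : Fin (d + 1) → ℤˣ) ^ N := by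
    refine Fintype.sum_equiv (Fin.revPerm.arrowCongr (Equiv.refl _)) _ _ fun ε => ?_
    rw [signedSum_eq_fullSum]
    rfl
  rw [sum_snoc, sum_units_int, hrev, two_mul]
  congr 1
  rw [← Equiv.sum_comp (Equiv.neg (Fin d → ℤˣ))]
  refine Finset.sum_congr rfl fun ε _ => ?_
  rw [Equiv.neg_apply, hsnoc, hg, fullSum_neg, hN.neg_pow]

/-- One factor 2 comes from negation, which preserves the product of signs because `m` is even. The
other comes from adding the vanishing unsigned sum: `sign ε + 1` is twice the indicator of `sign ε =
1`. -/
lemma sum_prod_mul_fullSum_pow {m N : ℕ} (hm : 0 < m) (hd : Even m) (hN : Even N) {w : ℂ}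
    (hw : w ^ m = -1) (hwN : w ^ N = -1) :
    ∑ δ : Fin m → ℤˣ, ((∏ j, δ j : ℤˣ) : ℂ) * fullSum w δ ^ N =
      4 * ∑ ε : Fin (m - 1) → ℤˣ with sign ε = 1, signedSum m w ε ^ N := by
  obtain ⟨d, rfl⟩ := Nat.exists_eq_succ_of_ne_zero hm.ne'
  rw [Nat.succ_eq_add_one] at hd hw
  change ∑ δ : Fin (d + 1) → ℤˣ, ((∏ j, δ j : ℤˣ) : ℂ) * fullSum w δ ^ N =
    4 * ∑ ε : Fin d → ℤˣ with sign ε = 1, signedSum (d + 1) w ε ^ N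
  have h0 := sum_fullSum_pow_eq_zero hw hwN
  have h1 := sum_mul_fullSum_pow hN w (fun _ : Fin (d + 1) → ℤˣ => (1 : ℂ)) fun _ => rfl
  simp only [one_mul] at h1
  rw [h0] at h1
  have h2 := sum_mul_fullSum_pow hN w (fun δ : Fin (d + 1) → ℤˣ => ((∏ j, δ j : ℤˣ) : ℂ))
    fun δ => by
      simp only [Pi.neg_apply, Finset.prod_neg, Finset.card_univ, Fintype.card_fin,
        hd.neg_one_pow, one_mul]
  have hsign : ∀ ε : Fin d → ℤˣ,
      ((∏ j, (Fin.snoc (ε ∘ Fin.rev) 1 : Fin (d + 1) → ℤˣ) j : ℤˣ) : ℂ) = ((sign ε : ℤ) : ℂ) :=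
    fun ε => by
      rw [Fin.prod_univ_castSucc, sign_eq_prod]
      simp only [Fin.snoc_castSucc, Fin.snoc_last, mul_one, Function.comp_apply]
      rw [← Equiv.prod_comp Fin.revPerm ε]
      rfl
  simp only [hsign] at h2
  rw [h2, Finset.sum_filter]
  have h3 : ∑ ε : Fin d → ℤˣ, (((sign ε : ℤ) : ℂ) + 1) * signedSum (d + 1) w ε ^ N =
      ∑ ε : Fin d → ℤˣ, 2 * if sign ε = 1 then signedSum (d + 1) w ε ^ N else 0 := by
    refine Finset.sum_congr rfl fun ε _ => ?_
    by_cases h : sign ε = 1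
    · rw [if_pos h, h]
      norm_num
    · have : sign ε = -1 := by
        unfold sign at h ⊢
        split_ifs at h ⊢ <;> simp_all
      rw [if_neg h, this]
      simp
  simp only [add_mul, one_mul, Finset.sum_add_distrib, ← Finset.mul_sum] at h3
  linear_combination 2 * h3 + h1

end MZV

theorem theorem2 (m n : ℕ) (hm : 0 < m) (hn : 0 < n) (hm2 : Even m) :
    Summable (MZV.term (MZV.rep (2 * m) n)) ∧
    MZV.zeta (MZV.rep (2 * m) n) =
      (-1 : ℝ) ^ (n + 1 + m / 2) * Real.pi ^ (2 * m * n) /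
          ((2 : ℝ) ^ (m - 2) * ((2 * m * n + m).factorial : ℝ)) *
        (∑ ε : Fin (m - 1) → ℤˣ with MZV.sign ε = 1,
          MZV.signedSum m (Complex.exp (2 * (Real.pi : ℂ) * Complex.I / (2 * (m : ℂ)))) ε
            ^ (2 * m * n + m)).im := by
  refine ⟨MZV.summable_term_rep (by omega) n, ?_⟩
  obtain ⟨r, rfl⟩ : ∃ r, m = 2 * r + 2 := by
    obtain ⟨q, hq⟩ := hm2
    exact ⟨q - 1, by omega⟩
  set m := 2 * r + 2 with hmr
  set w := Complex.exp (2 * (Real.pi : ℂ) * Complex.I / (2 * (m : ℂ))) with hwdef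
  have hm0 : (m : ℂ) ≠ 0 := by exact_mod_cast hm.ne'
  have hprim : IsPrimitiveRoot (w ^ 2) m := by
    have := Complex.isPrimitiveRoot_exp m hm.ne'
    convert this using 1
    rw [hwdef, ← Complex.exp_nat_mul]
    congr 1
    push_cast
    field_simp
  have hwr : w ^ (r + 1) = Complex.I := by
    rw [hwdef, ← Complex.exp_nat_mul, ← Complex.exp_pi_div_two_mul_I]
    congr 1
    have : (m : ℂ) = 2 * (r + 1) := by rw [hmr]; push_cast; ring
    rw [this]
    have : (r : ℂ) + 1 ≠ 0 := by exact_mod_cast r.succ_ne_zero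
    push_cast
    field_simp
    rw [mul_div_right_comm, Complex.exp_pi_div_two_mul_I]
  have hwm : w ^ m = -1 := by
    rw [hmr, show 2 * r + 2 = (r + 1) * 2 by ring, pow_mul, hwr, Complex.I_sq]
  have hwN : w ^ (2 * m * n + m) = -1 := by
    rw [show 2 * m * n + m = m * (2 * n + 1) by ring, pow_mul, hwm]
    exact Odd.neg_one_pow ⟨n, rfl⟩
  -- This is the product of all `w ^ j`, the constant in the sine prefactor.
  have hwt : w ^ (m * (m - 1) / 2) = (-1) ^ r * Complex.I := by
    rw [show m * (m - 1) / 2 = (r + 1) * (2 * r + 1) by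
      rw [hmr, show (2 * r + 2) * (2 * r + 2 - 1) = 2 * ((r + 1) * (2 * r + 1)) by
        rw [show 2 * r + 2 - 1 = 2 * r + 1 by omega]; ring]
      omega, pow_mul, hwr, pow_succ, pow_mul, Complex.I_sq]
  have key := MZV.zeta_eq_sum_fullSum hm hprim n
  have hsum := MZV.sum_prod_mul_fullSum_pow hm hm2 (N := 2 * m * n + m)
    ⟨m * n + (r + 1), by rw [hmr]; ring⟩ hwm hwN
  rw [hsum, hwt] at key
  set A := ∑ ε : Fin (m - 1) → ℤˣ with MZV.sign ε = 1, MZV.signedSum m w ε ^ (2 * m * n + m)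
  have hIm : Complex.I ^ m = (-1) ^ (r + 1) := by
    rw [hmr, show 2 * r + 2 = 2 * (r + 1) by ring, pow_mul, Complex.I_sq]
  have hIN : Complex.I ^ (2 * m * n + m) = (-1) ^ (r + 1) := by
    rw [show 2 * m * n + m = m * (2 * n) + m by ring, pow_add, pow_mul, hIm, ← pow_mul,
      Even.neg_one_pow ⟨(r + 1) * n, by ring⟩, one_mul]
  have hpi : (Real.pi : ℂ) ≠ 0 := by exact_mod_cast Real.pi_ne_zero
  have hfac : ((2 * m * n + m).factorial : ℂ) ≠ 0 := by exact_mod_cast Nat.factorial_ne_zero _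
  -- The 4 cancels the factor 4 in `hsum`.
  have h2m : (2 : ℂ) ^ m = 4 * 2 ^ (m - 2) := by
    rw [← Nat.sub_add_cancel (show 2 ≤ m by omega), pow_add]
    norm_num
    ring
  have hC : (MZV.zeta (MZV.rep (2 * m) n) : ℂ) =
      (((-1 : ℝ) ^ (n + 1 + m / 2) * Real.pi ^ (2 * m * n) /
          ((2 : ℝ) ^ (m - 2) * ((2 * m * n + m).factorial : ℝ)) : ℝ) : ℂ) * (-Complex.I * A) := by
    rw [show n + 1 + m / 2 = n + r + 2 by omega]
    rw [mul_pow, mul_pow, hIm, hIN, h2m, pow_add (Real.pi : ℂ) (2 * m * n)] at key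
    push_cast
    have hs : ((-1 : ℂ) ^ (r + 1)) ≠ 0 := pow_ne_zero _ (by norm_num)
    have h1 : ∀ k : ℕ, ((-1 : ℂ) ^ k) * (-1) ^ k = 1 := fun k => by
      rw [← mul_pow]; norm_num
    have key2 : (-1) ^ r * Complex.I * ((-1) ^ n * (MZV.zeta (MZV.rep (2 * m) n) : ℂ)) =
        (Real.pi : ℂ) ^ (2 * m * n) / (2 ^ (m - 2) * (2 * m * n + m).factorial) * A := by
      apply mul_left_cancel₀ (pow_ne_zero m hpi)
      rw [← mul_assoc, key]
      field_simp
    calc (MZV.zeta (MZV.rep (2 * m) n) : ℂ)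
        = -Complex.I * ((-1) ^ n * (-1) ^ r) *
            ((-1) ^ r * Complex.I * ((-1) ^ n * (MZV.zeta (MZV.rep (2 * m) n) : ℂ))) := by
          linear_combination (-(MZV.zeta (MZV.rep (2 * m) n) : ℂ)) * (h1 r) * (-1) ^ n * (-1) ^ n
            - (MZV.zeta (MZV.rep (2 * m) n) : ℂ) * h1 n
            + ((-1) ^ n * (-1) ^ n * ((-1) ^ r * (-1) ^ r) *
              (MZV.zeta (MZV.rep (2 * m) n) : ℂ)) * Complex.I_sq
      _ = _ := by
          rw [key2, pow_add, pow_add]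
          ring
  -- Zeta and the prefactor are real, and the real part of `-I * A` is the imaginary part of `A`.
  have hre := congrArg Complex.re hC
  rw [Complex.ofReal_re, Complex.re_ofReal_mul] at hre
  rw [hre]
  simp
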